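/- **Definitions.** A *bimodal map* is a continuous map $f:[c_0,c_3]\to[c_0,c_3]$ with points $c_0<c_1<c_2<c_3$ such that $f$ is strictly increasing on $[c_0,c_1]$ and on $[c_2,c_3]$ and strictly decreasing on $[c_1,c_2]$. The symbol of a point $x$ is $L,A,M,B,R$ according to $x<c_1$, $x=c_1$, $c_1<x<c_2$, $x=c_2$, $x>c_2$. Conjugation of symbols is $\overline L=R$, $\overline R=L$, $\overline M=M$, $\overline A=B$, $\overline B=A$. Let $p\ge 1$ and let $\tilde P=\tilde P_1\cdots\tilde P_{p-1}$ be a word in $\{L,M,R\}$. The set $\mathcal D$ consists of the symmetric kneading data $S=(\tilde P A,\overline{\tilde P}B)$ (two periodic orbits) and $S=\tilde P B\,\overline{\tilde P}A$ (one periodic orbit through both turning points) that are realized by some bimodal map $f$, i.e. the symbols of $f(c_1),f^2(c_1),\dots$ form the periodic sequence with block $\tilde PA$, respectively $\tilde PB\overline{\tilde P}A$, and the symbols of $f(c_2),f^2(c_2),\dots$ form the conjugate sequence. Symbol sequences are ordered lexicographically by the signed symbols $\theta_j=\big(\prod_{i<j}\epsilon(S_i)\big)S_j$, where $\epsilon(L)=\epsilon(R)=1$,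 $\epsilon(M)=-1$, $\epsilon(A)=\epsilon(B)=0$ and $-R<-B<-M<-A<-L<0<L<A<M<B<R$. The set $\mathcal D_1$ consists of the $S\in\mathcal D$ whose first component (the sequence of $c_1$) lies between $M^\infty$ and $RM^\infty$. A *unimodal map* is a continuous self-map $g$ of an interval $[b_0,b_1]$ that is strictly increasing on $[b_0,c]$ and strictly decreasing on $[c,b_1]$ for some $b_0<c<b_1$; a point has symbol $\ell,c,r$ according to whether it is left of, equal to, or right of $c$. $\mathcal T_{KS}$ is the set of blocks $Pc$, $P$ a word in $\{\ell,r\}$, such that for some unimodal map $g$ the symbols of $g(c),g^2(c),\dots$ form the periodic sequence with block $Pc$. To $S\in\mathcal D_1$ with word $\tilde P$ corresponds the block $Pc$, where $P$ is obtained from $\tilde P$ by replacing $M$ by $\ell$ and both $L$ and $R$ by $r$. If $z_1<\dots<z_{m+1}$ are the points of the orbits of the turning points (including the turning points) of a map realizing given data, the Markov matrix of the data is the $m\times m$ matrix with entry $(i,j)$ equal to $1$ if $f([z_i,z_{i+1}])\supseteq[z_j,z_{j+1}]$ and to $0$ otherwise. **Proposition 1.** Let $S\in\mathcal D_1$, given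 by a word $\tilde P$ of length $p-1$, and let $Pc$ be the corresponding unimodal block. Then: 1. $Pc\in\mathcal T_{KS}$. 2. The Markov matrices $A_S$, of size $2p-1$, and $A_P$, of size $p-1$, are well defined, that is, each is the same for all maps realizing the data. Order the intervals $I_i=[z_i,z_{i+1}]$, $1\le i\le 2p-1$, of a map realizing $S$ as $I_p;\ I_{p-1},\dots,I_1;\ I_{p+1},\dots,I_{2p-1}$. In this order $$A_S=\begin{bmatrix}1&W_1&W_2\\0&0&A_P\\0&A_P&0\end{bmatrix}$$ for some $1\times(p-1)$ matrices $W_1,W_2$. If $p\ge2$, then $W_1\neq0$ and $W_2\neq0$; so the middle interval $I_p$ has a transition to itself, no other interval has a transition to it, and it has transitions into both other blocks (it is a transient state). 3. For every bimodal map $f$ realizing $S$, $\{z_1,\dots,z_p\}=\{f^{2j}(c_1)\}_{j\ge0}\cup\{f^{2j+1}(c_2)\}_{j\ge0}$ and $\{z_{p+1},\dots,z_{2p}\}=\{f^{2j+1}(c_1)\}_{j\ge0}\cup\{f^{2j}(c_2)\}_{j\ge0}$. Thus the two copies of $A_P$ describe the transitions between the intervals spanned by these two sets of points. -/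

import Mathlib

namespace SymBimodal

/-! ### Symbols and sequences -/

/-- The five symbols recording the position of a point relative to the two turning points. -/
inductive Sym
  | L | A | M | B | R

/-- The three laps (the symbols that are not turning points). -/
inductive Lap
  | L | M | R

/-- A lap regarded as a symbol. -/
def Lap.toSym : Lap → Sym
  | .L => .L
  | .M => .M
  | .R => .R

/-- The conjugation (bar): `L ↔ R`, `A ↔ B`, `M ↔ M`. -/
def Sym.conj : Sym → Sym
  | .L => .R
  | .A => .B
  | .M => .M
  | .B => .A
  | .R => .L

/-- `ε(L) = ε(R) = 1`, `ε(M) = -1`, `ε(A) = ε(B) = 0`. -/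
def Sym.eps : Sym → ℤ
  | .L => 1
  | .A => 0
  | .M => -1
  | .B => 0
  | .R => 1

/-- Position of a symbol, with `A` the midpoint of `L`, `M` and `B` the midpoint of `M`, `R`. The
signed values realize the order `-R < -B < -M < -A < -L < 0 < L < A < M < B < R`. -/
def Sym.val : Sym → ℤ
  | .L => 1
  | .A => 2
  | .M => 3
  | .B => 4
  | .R => 5

/-- The invariant coordinate `θ_j = (∏_{i<j} ε(s_i)) s_j` of a symbol sequence. -/
def theta (s : ℕ → Sym) (j : ℕ) : ℤ :=
  (∏ i ∈ Finset.range j, (s i).eps) * (s j).val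

/-- The order of symbol sequences: lexicographic order of the invariant coordinates. -/
def SeqLT (s t : ℕ → Sym) : Prop :=
  ∃ j, (∀ i < j, theta s i = theta t i) ∧ theta s j < theta t j

/-- The sequence `M^∞`. -/
def seqM : ℕ → Sym := fun _ => .M

/-- The sequence `R M^∞`. -/
def seqRM : ℕ → Sym := fun i => if i = 0 then .R else .M

/-! ### Symmetric kneading data -/

/-- Symmetric kneading data with periodic turning points, given by a block `P = P₁ … P_{p-1}` of
laps: `pair P` is the pair of orbits `(P A, P̄ B)`, and `doubly P` is the single orbit
`P B P̄ A` through both turning points. -/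
inductive Data
  | pair (P : List Lap)
  | doubly (P : List Lap)

/-- The block `P₁ … P_{p-1}`. -/
def Data.word : Data → List Lap
  | .pair P => P
  | .doubly P => P

/-- The periodic block of the kneading sequence of the first turning point. -/
def Data.block : Data → List Sym
  | .pair P => P.map Lap.toSym ++ [.A]
  | .doubly P => P.map Lap.toSym ++ [.B] ++ P.map (fun X => X.toSym.conj) ++ [.A]

/-- The kneading sequence `S₁ S₂ S₃ …` of the first turning point (`S.seq i = S_{i+1}`): the
periodic repetition of the block. -/
def Data.seq (S : Data) (i : ℕ) : Sym :=
  S.block.getD (i % S.block.length) .A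

/-! ### Bimodal maps -/

/-- `f` is a bimodal map of `[c₀, c₃]` into itself with turning points `c₁ < c₂`. -/
structure IsBimodal (f : ℝ → ℝ) (c₀ c₁ c₂ c₃ : ℝ) : Prop where
  lt₀₁ : c₀ < c₁
  lt₁₂ : c₁ < c₂
  lt₂₃ : c₂ < c₃
  mapsTo : Set.MapsTo f (Set.Icc c₀ c₃) (Set.Icc c₀ c₃)
  continuousOn : ContinuousOn f (Set.Icc c₀ c₃)
  incr_left : StrictMonoOn f (Set.Icc c₀ c₁)
  decr_middle : StrictAntiOn f (Set.Icc c₁ c₂)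
  incr_right : StrictMonoOn f (Set.Icc c₂ c₃)

open Classical in
/-- The symbol of a point `x` relative to `c₁ < c₂`. -/
noncomputable def address (c₁ c₂ x : ℝ) : Sym :=
  if x < c₁ then .L else if x = c₁ then .A else if x < c₂ then .M else if x = c₂ then .B else .R

/-- `f` is a bimodal map with kneading data `S`: the itinerary of `f(c₁)` is the sequence of `S`,
and the itinerary of `f(c₂)` is the conjugate sequence. The map is not required to be odd. -/
def Data.RealizedBy (S : Data) (f : ℝ → ℝ) (c₀ c₁ c₂ c₃ : ℝ) : Prop :=
  IsBimodal f c₀ c₁ c₂ c₃ ∧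
    ∀ j : ℕ, address c₁ c₂ (f^[j + 1] c₁) = S.seq j ∧
      address c₁ c₂ (f^[j + 1] c₂) = (S.seq j).conj

/-- The set `𝒟` of realizable symmetric kneading data. -/
def setD : Set Data :=
  {S | ∃ (f : ℝ → ℝ) (c₀ c₁ c₂ c₃ : ℝ), S.RealizedBy f c₀ c₁ c₂ c₃}

/-- The set `𝒟₁` of elements of `𝒟` between `(M^∞, M^∞)` and `(R M^∞, L M^∞)`; symmetric data are
ordered by their first components. -/
def setD₁ : Set Data :=
  {S | S ∈ setD ∧ SeqLT seqM S.seq ∧ SeqLT S.seq seqRM}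

/-! ### Unimodal maps -/

/-- The symbols of unimodal dynamics: left of, at, and right of the turning point. -/
inductive USym
  | l | c | r

/-- The two laps of a unimodal map. -/
inductive ULap
  | l | r

/-- A unimodal lap regarded as a symbol. -/
def ULap.toUSym : ULap → USym
  | .l => .l
  | .r => .r

/-- `g` is a unimodal map of `[b₀, b₁]` into itself with its maximum at `c`. -/
structure IsUnimodal (g : ℝ → ℝ) (b₀ c b₁ : ℝ) : Prop where
  lt_left : b₀ < c
  lt_right : c < b₁
  mapsTo : Set.MapsTo g (Set.Icc b₀ b₁) (Set.Icc b₀ b₁)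
  continuousOn : ContinuousOn g (Set.Icc b₀ b₁)
  incr_left : StrictMonoOn g (Set.Icc b₀ c)
  decr_right : StrictAntiOn g (Set.Icc c b₁)

open Classical in
/-- The symbol of a point `x` relative to the turning point `c`. -/
noncomputable def uaddress (c x : ℝ) : USym :=
  if x < c then .l else if x = c then .c else .r

/-- The periodic sequence with block `P c`. -/
def useq (P : List ULap) (i : ℕ) : USym :=
  (P.map ULap.toUSym ++ [USym.c]).getD (i % (P.length + 1)) USym.c

/-- `g` is a unimodal map whose turning point is periodic with kneading sequence `(P c)^∞`. -/
def URealizedBy (P : List ULap) (g : ℝ → ℝ) (b₀ c b₁ : ℝ) : Prop :=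
  IsUnimodal g b₀ c b₁ ∧ ∀ j : ℕ, uaddress c (g^[j + 1] c) = useq P j

/-- The set `𝒯_KS` of unimodal kneading sequences `P c` (recorded by the block `P`). -/
def setT : Set (List ULap) :=
  {P | ∃ (g : ℝ → ℝ) (b₀ c b₁ : ℝ), URealizedBy P g b₀ c b₁}

/-- The correspondence of symbols: `M` corresponds to `l`, and both `L` and `R` to `r`. -/
def Lap.toULap : Lap → ULap
  | .L => .r
  | .M => .l
  | .R => .r

/-- The block of the unimodal kneading sequence that corresponds to `S`. -/
def Data.unimodal (S : Data) : List ULap := S.word.map Lap.toULap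

/-! ### Markov matrices -/

/-- `z 0 < z 1 < … < z m` is the increasing enumeration of the set `X`. -/
def IsEnumeration {m : ℕ} (z : Fin (m + 1) → ℝ) (X : Set ℝ) : Prop :=
  StrictMono z ∧ Set.range z = X

open Classical in
/-- The transition matrix of `f` for the intervals `I_i = [z i, z (i + 1)]`: the entry `(i, j)` is
`1` if `f(I_i) ⊇ I_j`, and `0` otherwise. -/
noncomputable def transitionMatrix {m : ℕ} (f : ℝ → ℝ) (z : Fin (m + 1) → ℝ) :
    Matrix (Fin m) (Fin m) ℤ :=
  Matrix.of fun i j =>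
    if Set.Icc (z j.castSucc) (z j.succ) ⊆ f '' Set.Icc (z i.castSucc) (z i.succ) then 1 else 0

/-- The forward orbit of `x`, including `x`. -/
def orbit (f : ℝ → ℝ) (x : ℝ) : Set ℝ := Set.range fun j : ℕ => f^[j] x

/-- The points `f^j(x)` with `j` even. -/
def evenOrbit (f : ℝ → ℝ) (x : ℝ) : Set ℝ := Set.range fun j : ℕ => f^[2 * j] x

/-- The points `f^j(x)` with `j` odd. -/
def oddOrbit (f : ℝ → ℝ) (x : ℝ) : Set ℝ := Set.range fun j : ℕ => f^[2 * j + 1] x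

/-- `A` is the Markov matrix `A_S` of the realizable data `S`: for every bimodal map with kneading
data `S`, it is the transition matrix of the partition by the points of the two turning orbits. -/
def Data.IsMarkovMatrix (S : Data) {m : ℕ} (A : Matrix (Fin m) (Fin m) ℤ) : Prop :=
  S ∈ setD ∧ ∀ (f : ℝ → ℝ) (c₀ c₁ c₂ c₃ : ℝ), S.RealizedBy f c₀ c₁ c₂ c₃ →
    ∃ z : Fin (m + 1) → ℝ, IsEnumeration z (orbit f c₁ ∪ orbit f c₂) ∧ A = transitionMatrix f z

/-- `A` is the Markov matrix `A_P` of the unimodal kneading sequence `P c`: for every unimodal map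
with this kneading sequence, it is the transition matrix of the partition by the points of the
turning orbit. -/
def UIsMarkovMatrix (P : List ULap) {m : ℕ} (A : Matrix (Fin m) (Fin m) ℤ) : Prop :=
  P ∈ setT ∧ ∀ (g : ℝ → ℝ) (b₀ c b₁ : ℝ), URealizedBy P g b₀ c b₁ →
    ∃ w : Fin (m + 1) → ℝ, IsEnumeration w (orbit g c) ∧ A = transitionMatrix g w

/-- The position, in the left-to-right order, of each state of the block decomposition. -/
def blockIndex (n : ℕ) : Unit ⊕ (Fin n ⊕ Fin n) → Fin (2 * n + 1)
  | .inl _ => ⟨n, by omega⟩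
  | .inr (.inl i) => ⟨n - 1 - i, by omega⟩
  | .inr (.inr i) => ⟨n + 1 + i, by omega⟩

theorem blockIndex_bijective (n : ℕ) : Function.Bijective (blockIndex n) := by
  rw [Fintype.bijective_iff_injective_and_card]
  constructor
  · rintro (_ | a | a) (_ | b | b) h <;> simp only [blockIndex, Fin.mk.injEq] at h
    · rfl
    · have := b.isLt; omega
    · omega
    · have := a.isLt; omega
    · have : a = b := by
        ext
        have := a.isLt
        have := b.isLt
        omega
      rw [this]
    · have := a.isLt; omega
    · omega
    · have := b.isLt; omega
    · have : a = b := by ext; omega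
      rw [this]
  · simp only [Fintype.card_sum, Fintype.card_unit, Fintype.card_fin]; omega

/-- The reordering of the `2 n + 1` intervals: first the middle one, then the `n` intervals to its
left (enumerated from right to left), then the `n` intervals to its right (from left to right). -/
noncomputable def blockEquiv (n : ℕ) : Unit ⊕ (Fin n ⊕ Fin n) ≃ Fin (2 * n + 1) :=
  Equiv.ofBijective (blockIndex n) (blockIndex_bijective n)

end SymBimodal

namespace SymBimodal

/-!
A point of `𝒟₁` forces a fixed point `q` in the middle lap. Its itinerary is `M^∞`, so the bounds
`M^∞ < S < R M^∞` say that the first two iterates of a turning point lie on opposite sides of `q`.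
Hence `f` interchanges the two sides of `q` along the turning orbits. The points on the right,
`f^{2j}(c₂)` and `f^{2j+1}(c₁)`, and the reflected points on the left are each mapped to the other
as by a unimodal map with kneading block `P c`.

Whether `x_i < x_j` in such a pair of sequences is decided by the sides of the turning point on
which the two points lie, or else by their images; since the turning point is periodic, the block
`P c` alone determines the order. Both halves and the turning orbit of any unimodal map with block
`P c` are therefore order isomorphic. An interpolating homeomorphism between the halves turns `f`
into a unimodal map, and the transition matrices depend only on the common order.
-/

/-! ### Orders determined by a unimodal kneading sequence -/

theorem uaddress_of_lt {c x : ℝ} (h : x < c) : uaddress c x = .l := if_pos h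

theorem uaddress_self (c : ℝ) : uaddress c c = .c := by simp [uaddress]

theorem uaddress_of_gt {c x : ℝ} (h : c < x) : uaddress c x = .r := by
  simp [uaddress, h.le, h.ne']

theorem uaddress_eq_c_iff {c x : ℝ} : uaddress c x = .c ↔ x = c := by
  rcases lt_trichotomy x c with h | rfl | h
  · simp [uaddress_of_lt h, h.ne]
  · simp [uaddress_self]
  · simp [uaddress_of_gt h, h.ne']

theorem cmp_eq_cmp_of_uaddress_eq {c c' x x' : ℝ} (h : uaddress c x = uaddress c' x') :
    cmp x c = cmp x' c' := by
  rcases lt_trichotomy x c with hx | rfl | hx <;>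
  rcases lt_trichotomy x' c' with hx' | rfl | hx' <;>
    simp_all [uaddress_of_lt, uaddress_self, uaddress_of_gt, LT.lt.cmp_eq_lt, LT.lt.cmp_eq_gt]

theorem useq_eq_c_iff {P : List ULap} {k : ℕ} : useq P k = .c ↔ P.length + 1 ∣ k + 1 := by
  rw [Nat.dvd_iff_mod_eq_zero, Nat.succ_mod_succ_eq_zero_iff]
  rcases (Nat.lt_succ_iff.1 (Nat.mod_lt k P.length.succ_pos)).lt_or_eq with h | h
  · have hne : (P[k % (P.length + 1)]).toUSym ≠ .c := by
      cases P[k % (P.length + 1)] <;> simp [ULap.toUSym]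
    simp_all [useq, List.getElem?_append_left, h.ne]
  · simp [useq, h]

section Folds

variable {P : List ULap} {n : ℕ} {x y x' y' : ℕ → ℝ}

/-- As far as order is concerned, the rule `x i ↦ y (i + 1)` is unimodal with turning point `x 0`;
the positions of the points of `x` relative to `x 0` are those prescribed by the block `P c`. -/
structure IsFold (P : List ULap) (x y : ℕ → ℝ) : Prop where
  uaddress_eq : ∀ k, uaddress (x 0) (x (k + 1)) = useq P k
  cmp_left : ∀ i j, x i ≤ x 0 → x j ≤ x 0 → cmp (y (i + 1)) (y (j + 1)) = cmp (x i) (x j)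
  cmp_right : ∀ i j, x 0 ≤ x i → x 0 ≤ x j → cmp (y (i + 1)) (y (j + 1)) = cmp (x j) (x i)

namespace IsFold

theorem cmp_zero_eq (h : IsFold P x y) (h' : IsFold P x' y') (k : ℕ) :
    cmp (x k) (x 0) = cmp (x' k) (x' 0) := by
  rcases k with _ | k
  · simp only [cmp_self_eq_eq]
  · exact cmp_eq_cmp_of_uaddress_eq ((h.uaddress_eq k).trans (h'.uaddress_eq k).symm)

theorem eq_zero_iff (h : IsFold P x y) {k : ℕ} : x k = x 0 ↔ P.length + 1 ∣ k := by
  rcases k with _ | k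
  · simp
  · rw [← uaddress_eq_c_iff, h.uaddress_eq, useq_eq_c_iff]

theorem succ_eq (h : IsFold P x y) {i j : ℕ} (hij : x i = x j) : y (i + 1) = y (j + 1) := by
  rw [← cmp_eq_eq_iff]
  rcases le_total (x i) (x 0) with hi | hi
  · rw [h.cmp_left i j hi (hij ▸ hi), hij, cmp_self_eq_eq]
  · rw [h.cmp_right i j hi (hij ▸ hi), hij, cmp_self_eq_eq]

end IsFold

/-- Two sequences folded onto each other with the same kneading sequence. A periodic turning orbit
of a unimodal map is such a pair with `x = y`. -/
def IsFoldPair (P : List ULap) (x y : ℕ → ℝ) : Prop := IsFold P x y ∧ IsFold P y x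

namespace IsFoldPair

theorem symm (h : IsFoldPair P x y) : IsFoldPair P y x := ⟨h.2, h.1⟩

-- The order of `x i` and `x j` is decided by their sides of `x 0` or else by the order of
-- `y (i + 1)` and `y (j + 1)`; this recursion stops when the first index returns to the turning
-- point.
theorem cmp_eq_of_dvd (h : IsFoldPair P x y) (h' : IsFoldPair P x' y') {N i : ℕ} (j : ℕ)
    (hN : P.length + 1 ∣ i + N) : cmp (x i) (x j) = cmp (x' i) (x' j) := by
  have zero_eq := h.1.cmp_zero_eq h'.1
  induction N generalizing i j x y x' y' with
  | zero =>
    rw [add_zero] at hN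
    rw [h.1.eq_zero_iff.2 hN, h'.1.eq_zero_iff.2 hN, cmp_eq_cmp_symm]
    exact zero_eq j
  | succ N ih =>
    have next : cmp (y (i + 1)) (y (j + 1)) = cmp (y' (i + 1)) (y' (j + 1)) :=
      ih h.symm h'.symm (j + 1) (by rwa [add_right_comm]) (h.2.cmp_zero_eq h'.2)
    have lt_iff k := lt_iff_lt_of_cmp_eq_cmp (zero_eq k)
    have le_iff k := le_iff_le_of_cmp_eq_cmp (zero_eq k)
    have ge_iff k := le_iff_le_of_cmp_eq_cmp (cmp_eq_cmp_symm.1 (zero_eq k))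
    have gt_iff k := lt_iff_lt_of_cmp_eq_cmp (cmp_eq_cmp_symm.1 (zero_eq k))
    rcases lt_or_ge (x i) (x 0) with hi | hi
    · rcases lt_or_ge (x 0) (x j) with hj | hj
      · rw [(hi.trans hj).cmp_eq_lt, (((lt_iff i).1 hi).trans ((gt_iff j).1 hj)).cmp_eq_lt]
      · rwa [h.1.cmp_left i j hi.le hj,
          h'.1.cmp_left i j ((lt_iff i).1 hi).le ((le_iff j).1 hj)] at next
    · rcases lt_or_ge (x j) (x 0) with hj | hj
      · rw [(hj.trans_le hi).cmp_eq_gt, (((lt_iff j).1 hj).trans_le ((ge_iff i).1 hi)).cmp_eq_gt]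
      · rwa [h.1.cmp_right i j hi hj, h'.1.cmp_right i j ((ge_iff i).1 hi) ((ge_iff j).1 hj),
          cmp_eq_cmp_symm] at next

theorem cmp_eq (h : IsFoldPair P x y) (h' : IsFoldPair P x' y') (i j : ℕ) :
    cmp (x i) (x j) = cmp (x' i) (x' j) :=
  h.cmp_eq_of_dvd h' j (N := P.length * i) ⟨i, by ring⟩

theorem succ_eq (h : IsFoldPair P x y) {i j : ℕ} (hij : x i = x j) : x (i + 1) = x (j + 1) :=
  (eq_iff_eq_of_cmp_eq_cmp (h.symm.cmp_eq h _ _)).1 (h.1.succ_eq hij)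

theorem add_eq (h : IsFoldPair P x y) {i j : ℕ} (hij : x i = x j) (k : ℕ) :
    x (i + k) = x (j + k) := by
  induction k with
  | zero => exact hij
  | succ k ih => exact h.succ_eq ih

theorem periodic (h : IsFoldPair P x y) : Function.Periodic x (P.length + 1) := fun k => by
  rw [add_comm, h.add_eq (h.1.eq_zero_iff.2 dvd_rfl), zero_add]

-- If `x i = x j` with `i < j`, then shifting by `P.length + 1 - j` gives an early return to `x 0`.
theorem injective (h : IsFoldPair P x y) :
    Function.Injective fun k : Fin (P.length + 1) => x k := by
  refine Function.Injective.of_lt_imp_ne fun i j hij heq => ?_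
  have hreturn : x (i + (P.length + 1 - j)) = x 0 := by
    rw [h.add_eq heq, h.1.eq_zero_iff, Nat.add_sub_cancel' j.is_lt.le]
  have := Nat.le_of_dvd (by omega) (h.1.eq_zero_iff.1 hreturn)
  omega

end IsFoldPair

theorem URealizedBy.isFoldPair {g : ℝ → ℝ} {b₀ c b₁ : ℝ} (h : URealizedBy P g b₀ c b₁) :
    IsFoldPair P (fun k => g^[k] c) (fun k => g^[k] c) := by
  have hmem (k) : g^[k] c ∈ Set.Icc b₀ b₁ :=
    h.1.mapsTo.iterate k ⟨h.1.lt_left.le, h.1.lt_right.le⟩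
  have hfold : IsFold P (fun k => g^[k] c) (fun k => g^[k] c) :=
    { uaddress_eq := h.2
      cmp_left := fun i j hi hj => by
        simp only [Function.iterate_succ_apply']
        exact h.1.incr_left.cmp_map_eq ⟨(hmem i).1, hi⟩ ⟨(hmem j).1, hj⟩
      cmp_right := fun i j hi hj => by
        simp only [Function.iterate_succ_apply']
        exact h.1.decr_right.cmp_map_eq ⟨hi, (hmem i).2⟩ ⟨hj, (hmem j).2⟩ }
  exact ⟨hfold, hfold⟩

/-- The permutation `π` lists the indices `0, …, n` of the sequence `x`, of period `n + 1`, by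
increasing size of the terms of `x`. -/
structure HasPattern {α : Type*} [Preorder α] (π : Equiv.Perm (Fin (n + 1))) (x : ℕ → α) :
    Prop where
  periodic : Function.Periodic x (n + 1)
  strictMono : StrictMono fun i => x (π i)

/-- The position, in the order described by `π`, of the term that follows the term at position
`i`. -/
def nextIndex (π : Equiv.Perm (Fin (n + 1))) (i : Fin (n + 1)) : Fin (n + 1) :=
  π.symm (π i + 1)

theorem nextIndex_zero_ne (hn : n ≠ 0) (π : Equiv.Perm (Fin (n + 1))) : nextIndex π 0 ≠ 0 := by
  rw [nextIndex, ne_eq, Equiv.symm_apply_eq, add_eq_left, Fin.one_eq_zero_iff]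
  omega

section Periodic

variable {α : Type*} {x : ℕ → α}

theorem apply_symm_ofNat_of_periodic (hx : Function.Periodic x (n + 1))
    (π : Equiv.Perm (Fin (n + 1))) (k : ℕ) :
    x (π (π.symm (Fin.ofNat (n + 1) k))) = x k := by
  simpa using hx.map_mod_nat k

theorem range_comp_perm_of_periodic (hx : Function.Periodic x (n + 1))
    (π : Equiv.Perm (Fin (n + 1))) : Set.range (fun i => x (π i)) = Set.range x := by
  refine (Set.range_comp_subset_range _ x).antisymm ?_
  rintro _ ⟨k, rfl⟩
  exact ⟨_, apply_symm_ofNat_of_periodic hx π k⟩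

theorem apply_succ_of_periodic (hx : Function.Periodic x (n + 1)) (π : Equiv.Perm (Fin (n + 1)))
    (i : Fin (n + 1)) : x (π i + 1) = x (π (nextIndex π i)) := by
  have hcast : Fin.ofNat (n + 1) (π i + 1) = π i + 1 := by simp [Fin.ext_iff, Fin.val_add]
  rw [← apply_symm_ofNat_of_periodic hx π (π i + 1), nextIndex, hcast]

end Periodic

/-- The permutation `π` is the pattern of every fold pair with block `P`. -/
def IsPattern (P : List ULap) (π : Equiv.Perm (Fin (n + 1))) : Prop :=
  ∀ x y, IsFoldPair P x y → HasPattern π x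

theorem exists_isPattern (hn : P.length = n) : ∃ π : Equiv.Perm (Fin (n + 1)), IsPattern P π := by
  subst hn
  by_cases hex : ∃ x y, IsFoldPair P x y
  · obtain ⟨x, y, h⟩ := hex
    set π := Tuple.sort fun k : Fin (P.length + 1) => x k
    have hmono : StrictMono fun i => x (π i) :=
      (Tuple.monotone_sort _).strictMono_of_injective (h.injective.comp π.injective)
    refine ⟨π, fun x' y' h' => ⟨h'.periodic, fun i j hij => ?_⟩⟩
    exact (lt_iff_lt_of_cmp_eq_cmp (h.cmp_eq h' _ _)).1 (hmono hij)
  · exact ⟨1, fun x y h => (hex ⟨x, y, h⟩).elim⟩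

end Folds

/-! ### Transition matrices determined by the order of the division points -/

/-- The transition matrix determined by the images of the division points: the interval between
consecutive points is mapped onto the interval between their images. -/
def coverMatrix {m : ℕ} (σ : Fin (m + 1) → Fin (m + 1)) : Matrix (Fin m) (Fin m) ℤ :=
  Matrix.of fun i j =>
    if min (σ i.castSucc) (σ i.succ) ≤ j.castSucc ∧ j.succ ≤ max (σ i.castSucc) (σ i.succ)
    then 1 else 0

theorem image_Icc_of_monotoneOn_or_antitoneOn {f : ℝ → ℝ} {a b : ℝ} (hab : a ≤ b)
    (hc : ContinuousOn f (Set.Icc a b))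
    (hm : MonotoneOn f (Set.Icc a b) ∨ AntitoneOn f (Set.Icc a b)) :
    f '' Set.Icc a b = Set.Icc (min (f a) (f b)) (max (f a) (f b)) := by
  have ha := Set.left_mem_Icc.2 hab
  have hb := Set.right_mem_Icc.2 hab
  rcases hm with hm | hm
  · rw [hc.image_Icc_of_monotoneOn hab hm, min_eq_left (hm ha hb hab), max_eq_right (hm ha hb hab)]
  · rw [hc.image_Icc_of_antitoneOn hab hm, min_eq_right (hm ha hb hab), max_eq_left (hm ha hb hab)]

theorem transitionMatrix_eq_coverMatrix {m : ℕ} {f : ℝ → ℝ} {z : Fin (m + 1) → ℝ}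
    {σ : Fin (m + 1) → Fin (m + 1)} (hz : StrictMono z) (hσ : ∀ i, f (z i) = z (σ i))
    (hc : ∀ i : Fin m, ContinuousOn f (Set.Icc (z i.castSucc) (z i.succ)))
    (hm : ∀ i : Fin m, MonotoneOn f (Set.Icc (z i.castSucc) (z i.succ)) ∨
      AntitoneOn f (Set.Icc (z i.castSucc) (z i.succ))) :
    transitionMatrix f z = coverMatrix σ := by
  have hle (k : Fin m) : z k.castSucc ≤ z k.succ := (hz k.castSucc_lt_succ).le
  ext i j
  classical
  rw [transitionMatrix, coverMatrix, Matrix.of_apply, Matrix.of_apply]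
  refine if_congr ?_ rfl rfl
  rw [image_Icc_of_monotoneOn_or_antitoneOn (hle i) (hc i) (hm i), Set.Icc_subset_Icc_iff (hle j),
    hσ, hσ, ← hz.monotone.map_min, ← hz.monotone.map_max, hz.le_iff_le, hz.le_iff_le]

theorem le_castSucc_or_succ_le_of_mem_range {m : ℕ} {α : Type*} [Preorder α] {z : Fin (m + 1) → α}
    (hz : Monotone z) {x : α} (hx : x ∈ Set.range z) (i : Fin m) :
    x ≤ z i.castSucc ∨ z i.succ ≤ x := by
  obtain ⟨k, rfl⟩ := hx
  exact (lt_or_ge k i.succ).imp (fun h => hz (Fin.le_castSucc_iff.2 h)) fun h => hz h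

section Mirror

variable {n : ℕ} {α : Type*} {τ : Fin (n + 1) → Fin (n + 1)} {w w' : Fin (n + 1) → α}

/-- Numbering of `2 (n + 1)` points on a line by their distance from the middle: `inl i` is the
`i`-th point on the left and `inr i` the `i`-th point on the right, counting outwards from `0`. -/
def mirrorEquiv (n : ℕ) : Fin (n + 1) ⊕ Fin (n + 1) ≃ Fin (2 * n + 1 + 1) :=
  ((Equiv.sumCongr Fin.revPerm (Equiv.refl _)).trans finSumFinEquiv).trans (finCongr (by omega))

theorem val_mirrorEquiv_inl (i : Fin (n + 1)) : (mirrorEquiv n (.inl i) : ℕ) = n - i := by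
  simp [mirrorEquiv]

theorem val_mirrorEquiv_inr (i : Fin (n + 1)) : (mirrorEquiv n (.inr i) : ℕ) = n + 1 + i := by
  simp [mirrorEquiv, add_comm]

theorem mirrorEquiv_inl_le_inl {i j : Fin (n + 1)} :
    mirrorEquiv n (.inl i) ≤ mirrorEquiv n (.inl j) ↔ j ≤ i := by
  simp only [Fin.le_def, val_mirrorEquiv_inl]; omega

theorem mirrorEquiv_inr_le_inr {i j : Fin (n + 1)} :
    mirrorEquiv n (.inr i) ≤ mirrorEquiv n (.inr j) ↔ i ≤ j := by
  simp only [Fin.le_def, val_mirrorEquiv_inr]; omega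

theorem mirrorEquiv_inl_lt_inr (i j : Fin (n + 1)) :
    mirrorEquiv n (.inl i) < mirrorEquiv n (.inr j) := by
  simp only [Fin.lt_def, val_mirrorEquiv_inl, val_mirrorEquiv_inr]; omega

theorem setOf_val_le_eq_range :
    {k : Fin (2 * n + 1 + 1) | (k : ℕ) ≤ n} = Set.range (mirrorEquiv n ∘ .inl) := by
  ext k
  obtain ⟨i | i, rfl⟩ := (mirrorEquiv n).surjective k
  · exact iff_of_true (by rw [Set.mem_ofPred_eq, val_mirrorEquiv_inl]; omega) ⟨i, rfl⟩
  · exact iff_of_false (by rw [Set.mem_ofPred_eq, val_mirrorEquiv_inr]; omega) (by simp)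

theorem setOf_lt_val_eq_range :
    {k : Fin (2 * n + 1 + 1) | n < (k : ℕ)} = Set.range (mirrorEquiv n ∘ .inr) := by
  ext k
  obtain ⟨i | i, rfl⟩ := (mirrorEquiv n).surjective k
  · exact iff_of_false (by rw [Set.mem_ofPred_eq, val_mirrorEquiv_inl]; omega) (by simp)
  · exact iff_of_true (by rw [Set.mem_ofPred_eq, val_mirrorEquiv_inr]; omega) ⟨i, rfl⟩

/-- The sequence that runs through `w` backwards and then through `w'`. -/
def mirrorJoin (w w' : Fin (n + 1) → α) : Fin (2 * n + 1 + 1) → α :=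
  Sum.elim w w' ∘ (mirrorEquiv n).symm

@[simp]
theorem mirrorJoin_inl (i : Fin (n + 1)) : mirrorJoin w w' (mirrorEquiv n (.inl i)) = w i := by
  simp [mirrorJoin]

@[simp]
theorem mirrorJoin_inr (i : Fin (n + 1)) : mirrorJoin w w' (mirrorEquiv n (.inr i)) = w' i := by
  simp [mirrorJoin]

theorem mirrorJoin_image_val_le : mirrorJoin w w' '' {k | (k : ℕ) ≤ n} = Set.range w := by
  rw [setOf_val_le_eq_range, ← Set.range_comp]
  exact congrArg _ (funext mirrorJoin_inl)

theorem mirrorJoin_image_lt_val : mirrorJoin w w' '' {k | n < (k : ℕ)} = Set.range w' := by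
  rw [setOf_lt_val_eq_range, ← Set.range_comp]
  exact congrArg _ (funext mirrorJoin_inr)

theorem range_mirrorJoin : Set.range (mirrorJoin w w') = Set.range w ∪ Set.range w' := by
  rw [mirrorJoin, EquivLike.range_comp, Set.Sum.elim_range]

theorem strictMono_mirrorJoin [Preorder α] (hw : StrictAnti w) (hw' : StrictMono w')
    (h : ∀ i j, w i < w' j) : StrictMono (mirrorJoin w w') := by
  intro k l hkl
  obtain ⟨i | i, rfl⟩ := (mirrorEquiv n).surjective k <;>
  obtain ⟨j | j, rfl⟩ := (mirrorEquiv n).surjective l <;>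
  simp only [mirrorJoin_inl, mirrorJoin_inr]
  · exact hw (lt_iff_lt_of_le_iff_le mirrorEquiv_inl_le_inl |>.1 hkl)
  · exact h i j
  · exact (hkl.asymm (mirrorEquiv_inl_lt_inr j i)).elim
  · exact hw' (lt_iff_lt_of_le_iff_le mirrorEquiv_inr_le_inr |>.1 hkl)

/-- The map of `2 (n + 1)` points that sends the `i`-th point on either side of the middle to the
`τ i`-th point on the opposite side, counting outwards. -/
def swapMap (τ : Fin (n + 1) → Fin (n + 1)) : Fin (2 * n + 1 + 1) → Fin (2 * n + 1 + 1) :=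
  mirrorJoin (fun i => mirrorEquiv n (.inr (τ i))) fun i => mirrorEquiv n (.inl (τ i))

theorem apply_mirrorJoin {f : α → α} (h : ∀ i, f (w i) = w' (τ i)) (h' : ∀ i, f (w' i) = w (τ i))
    (k : Fin (2 * n + 1 + 1)) : f (mirrorJoin w w' k) = mirrorJoin w w' (swapMap τ k) := by
  obtain ⟨i | i, rfl⟩ := (mirrorEquiv n).surjective k <;> simp [swapMap, h, h']

/-- The transitions of the map `swapMap τ` from the middle interval to either side. -/
def middleRow (τ : Fin (n + 1) → Fin (n + 1)) : Matrix Unit (Fin n) ℤ :=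
  Matrix.of fun _ j => if j.succ ≤ τ 0 then 1 else 0

theorem middleRow_ne_zero (hn : 1 ≤ n) (h : τ 0 ≠ 0) : middleRow τ ≠ 0 := by
  intro hzero
  have hpos : (⟨0, hn⟩ : Fin n).succ ≤ τ 0 := Nat.pos_of_ne_zero fun h' => h (Fin.ext h')
  have hentry := congrFun₂ hzero () ⟨0, hn⟩
  rw [middleRow, Matrix.of_apply, if_pos hpos] at hentry
  exact one_ne_zero hentry

theorem blockEquiv_middle (u : Unit) :
    (blockEquiv n (.inl u)).castSucc = mirrorEquiv n (.inl 0) ∧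
      (blockEquiv n (.inl u)).succ = mirrorEquiv n (.inr 0) := by
  constructor <;> ext <;> simp [blockEquiv, blockIndex, val_mirrorEquiv_inl, val_mirrorEquiv_inr]

theorem blockEquiv_left (i : Fin n) :
    (blockEquiv n (.inr (.inl i))).castSucc = mirrorEquiv n (.inl i.succ) ∧
      (blockEquiv n (.inr (.inl i))).succ = mirrorEquiv n (.inl i.castSucc) := by
  constructor <;> ext <;> simp [blockEquiv, blockIndex, val_mirrorEquiv_inl] <;> omega

theorem blockEquiv_right (i : Fin n) :
    (blockEquiv n (.inr (.inr i))).castSucc = mirrorEquiv n (.inr i.castSucc) ∧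
      (blockEquiv n (.inr (.inr i))).succ = mirrorEquiv n (.inr i.succ) := by
  constructor <;> ext <;> simp [blockEquiv, blockIndex, val_mirrorEquiv_inr]; omega

theorem coverMatrix_swapMap (τ : Fin (n + 1) → Fin (n + 1)) :
    (coverMatrix (swapMap τ)).submatrix (blockEquiv n) (blockEquiv n) =
      Matrix.fromBlocks 1 (Matrix.fromCols (middleRow τ) (middleRow τ)) 0
        (Matrix.fromBlocks 0 (coverMatrix τ) (coverMatrix τ) 0) := by
  ext (_ | i | i) (_ | j | j) <;>
    simp only [Matrix.submatrix_apply, coverMatrix, Matrix.of_apply, middleRow, swapMap,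
      blockEquiv_middle, blockEquiv_left, blockEquiv_right, mirrorJoin_inl, mirrorJoin_inr,
      min_le_iff, le_max_iff, mirrorEquiv_inl_le_inl, mirrorEquiv_inr_le_inr,
      (mirrorEquiv_inl_lt_inr _ _).le, (mirrorEquiv_inl_lt_inr _ _).not_ge] <;>
    simp [or_comm, and_comm]

end Mirror

/-! ### Interpolation -/

section Interpolation

variable {K : Type*} [Field K] [LinearOrder K] [IsStrictOrderedRing K] [TopologicalSpace K]
  [OrderTopology K]

theorem exists_strictMono_extend_left {H : K → K} (hc : Continuous H) (hm : StrictMono H)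
    {u v a : K} (hu : u < a) (hv : v < H a) :
    ∃ G : K → K, Continuous G ∧ StrictMono G ∧ G u = v ∧ Set.EqOn G H (Set.Ici a) := by
  have hslope : 0 < (H a - v) / (a - u) := div_pos (sub_pos.2 hv) (sub_pos.2 hu)
  set G : K → K := fun x => H (max x a) + (H a - v) / (a - u) * min (x - a) 0
  have hright : Set.EqOn G H (Set.Ici a) := fun x hx => by
    simp [G, max_eq_left hx, min_eq_right (sub_nonneg.2 hx)]
  have hleft {x : K} (hx : x ≤ a) : G x = H a + (H a - v) / (a - u) * (x - a) := by
    simp only [G, max_eq_right hx, min_eq_left (sub_nonpos.2 hx)]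
  refine ⟨G, by fun_prop, StrictMonoOn.Iic_union_Ici (a := a) ?_ ?_, ?_, hright⟩
  · intro x hx y hy hxy
    rw [hleft hx, hleft hy]
    exact (add_lt_add_iff_left _).2 (mul_lt_mul_of_pos_left (sub_lt_sub_right hxy a) hslope)
  · exact (hm.strictMonoOn _).congr hright.symm
  · have : a - u ≠ 0 := (sub_pos.2 hu).ne'
    rw [hleft hu.le]
    field_simp
    ring

theorem exists_strictMono_interpolation {n : ℕ} {u v : Fin (n + 1) → K} (hu : StrictMono u)
    (hv : StrictMono v) : ∃ H : K → K, Continuous H ∧ StrictMono H ∧ ∀ i, H (u i) = v i := by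
  induction n with
  | zero =>
    refine ⟨fun x => x + (v 0 - u 0), by fun_prop, fun x y h => by simpa using h, fun i => ?_⟩
    rw [Fin.fin_one_eq_zero i]
    exact add_sub_cancel _ _
  | succ n ih =>
    obtain ⟨H, hc, hm, hH⟩ := ih (hu.comp Fin.strictMono_succ) (hv.comp Fin.strictMono_succ)
    simp only [Function.comp_apply] at hH
    obtain ⟨G, hGc, hGm, hGu, hGH⟩ := exists_strictMono_extend_left hc hm (hu (Fin.succ_pos 0))
      (v := v 0) (by rw [hH]; exact hv (Fin.succ_pos 0))
    refine ⟨G, hGc, hGm, Fin.cases hGu fun i => ?_⟩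
    rw [hGH (hu.monotone (Fin.succ_le_succ_iff.2 (Fin.zero_le i))), hH]

theorem HasPattern.exists_strictMono_map {n : ℕ} {π : Equiv.Perm (Fin (n + 1))} {x y : ℕ → K}
    (hx : HasPattern π x) (hy : HasPattern π y) {a b : K} (ha : ∀ k, a < x k)
    (hb : ∀ k, b < y k) :
    ∃ H : K → K, Continuous H ∧ StrictMono H ∧ H a = b ∧ ∀ k, H (x k) = y k := by
  obtain ⟨H, hc, hm, hH⟩ := exists_strictMono_interpolation
    (hx.strictMono.vecCons (ha _)) (hy.strictMono.vecCons (hb _))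
  refine ⟨H, hc, hm, hH 0, fun k => ?_⟩
  rw [← apply_symm_ofNat_of_periodic hx.periodic π,
    ← apply_symm_ofNat_of_periodic hy.periodic π]
  exact hH (Fin.succ _)

end Interpolation

/-! ### The order of itineraries -/

section SeqLTAt

variable {s t : ℕ → Sym} {j : ℕ}

/-- `j` is the first index at which the invariant coordinates of `s` and `t` differ, and `s` is the
smaller one there. -/
def SeqLTAt (j : ℕ) (s t : ℕ → Sym) : Prop :=
  (∀ i < j, theta s i = theta t i) ∧ theta s j < theta t j

theorem theta_zero (s : ℕ → Sym) : theta s 0 = (s 0).val := by simp [theta]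

theorem theta_succ (s : ℕ → Sym) (j : ℕ) :
    theta s (j + 1) = (s 0).eps * theta (fun k => s (k + 1)) j := by
  rw [theta, theta, Finset.prod_range_succ', mul_comm _ (s 0).eps, mul_assoc]

namespace SeqLTAt

theorem head_eq (h : SeqLTAt (j + 1) s t) : s 0 = t 0 := by
  have hval := h.1 0 j.succ_pos
  rw [theta_zero, theta_zero] at hval
  cases hs : s 0 <;> cases ht : t 0 <;> simp_all [Sym.val]

theorem tail (h : SeqLTAt (j + 1) s t) (he : (s 0).eps = 1) :
    SeqLTAt j (fun k => s (k + 1)) (fun k => t (k + 1)) := by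
  have htheta (i) : theta (fun k => s (k + 1)) i = theta s (i + 1) ∧
      theta (fun k => t (k + 1)) i = theta t (i + 1) := by
    rw [theta_succ s, theta_succ t, ← h.head_eq, he, one_mul, one_mul]
    exact ⟨rfl, rfl⟩
  simp only [SeqLTAt, htheta]
  exact ⟨fun i hi => h.1 _ (Nat.succ_lt_succ hi), h.2⟩

theorem tail_swap (h : SeqLTAt (j + 1) s t) (he : (s 0).eps = -1) :
    SeqLTAt j (fun k => t (k + 1)) (fun k => s (k + 1)) := by
  have htheta (i) : theta (fun k => s (k + 1)) i = -theta s (i + 1) ∧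
      theta (fun k => t (k + 1)) i = -theta t (i + 1) := by
    rw [theta_succ s, theta_succ t, ← h.head_eq, he, neg_one_mul, neg_one_mul, neg_neg, neg_neg]
    exact ⟨rfl, rfl⟩
  simp only [SeqLTAt, htheta, neg_inj, neg_lt_neg_iff]
  exact ⟨fun i hi => (h.1 _ (Nat.succ_lt_succ hi)).symm, h.2⟩

theorem eps_ne_zero (h : SeqLTAt (j + 1) s t) : (s 0).eps ≠ 0 := fun he => by
  have hlt := h.2
  rw [theta_succ, theta_succ, ← h.head_eq, he, zero_mul, zero_mul] at hlt
  exact hlt.false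

end SeqLTAt

theorem val_zero_le_of_seqLT (h : SeqLT s t) : (s 0).val ≤ (t 0).val := by
  obtain ⟨_ | j, hlt⟩ := h
  · simpa only [theta_zero] using hlt.2.le
  · exact (congrArg Sym.val (SeqLTAt.head_eq hlt)).le

end SeqLTAt

section Address

variable {c₁ c₂ x : ℝ}

theorem monotone_val_address (c₁ c₂ : ℝ) : Monotone fun x => (address c₁ c₂ x).val := by
  intro x y hxy
  simp only [address]
  split_ifs <;> simp only [Sym.val] <;> first | decide | (exfalso; grind)

theorem address_eq_L_iff : address c₁ c₂ x = .L ↔ x < c₁ := by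
  unfold address; split_ifs <;> simp_all

theorem address_eq_M_iff : address c₁ c₂ x = .M ↔ x ∈ Set.Ioo c₁ c₂ := by
  unfold address; split_ifs <;> grind

theorem address_eq_R_iff (h : c₁ < c₂) : address c₁ c₂ x = .R ↔ c₂ < x := by
  unfold address; split_ifs <;> grind

end Address

/-- The symbols of `x, f x, f² x, …`. -/
noncomputable def itinerary (f : ℝ → ℝ) (c₁ c₂ x : ℝ) (k : ℕ) : Sym := address c₁ c₂ (f^[k] x)

namespace IsBimodal

variable {f : ℝ → ℝ} {c₀ c₁ c₂ c₃ x y : ℝ}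

theorem lt_of_seqLTAt (h : IsBimodal f c₀ c₁ c₂ c₃) {j : ℕ} (hx : x ∈ Set.Icc c₀ c₃)
    (hy : y ∈ Set.Icc c₀ c₃) (hxy : SeqLTAt j (itinerary f c₁ c₂ x) (itinerary f c₁ c₂ y)) :
    x < y := by
  induction j generalizing x y with
  | zero =>
    have hlt := hxy.2
    rw [theta_zero, theta_zero] at hlt
    exact (monotone_val_address c₁ c₂).reflect_lt hlt
  | succ j ih =>
    have hlt := @ih (f x) (f y) (h.mapsTo hx) (h.mapsTo hy)
    have hgt := @ih (f y) (f x) (h.mapsTo hy) (h.mapsTo hx)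
    have hsymm : itinerary f c₁ c₂ y 0 = itinerary f c₁ c₂ x 0 := hxy.head_eq.symm
    cases hs : itinerary f c₁ c₂ x 0 with
    | L =>
      rw [hs] at hsymm
      exact (h.incr_left.lt_iff_lt ⟨hx.1, (address_eq_L_iff.1 hs).le⟩
        ⟨hy.1, (address_eq_L_iff.1 hsymm).le⟩).1 (hlt (hxy.tail (hs ▸ rfl)))
    | M =>
      rw [hs] at hsymm
      exact (h.decr_middle.lt_iff_gt (Set.Ioo_subset_Icc_self (address_eq_M_iff.1 hsymm))
        (Set.Ioo_subset_Icc_self (address_eq_M_iff.1 hs))).1 (hgt (hxy.tail_swap (hs ▸ rfl)))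
    | R =>
      rw [hs] at hsymm
      exact (h.incr_right.lt_iff_lt ⟨((address_eq_R_iff h.lt₁₂).1 hs).le, hx.2⟩
        ⟨((address_eq_R_iff h.lt₁₂).1 hsymm).le, hy.2⟩).1 (hlt (hxy.tail (hs ▸ rfl)))
    | A | B => exact (hxy.eps_ne_zero (hs ▸ rfl)).elim

theorem lt_of_seqLT (h : IsBimodal f c₀ c₁ c₂ c₃) (hx : x ∈ Set.Icc c₀ c₃)
    (hy : y ∈ Set.Icc c₀ c₃) (hxy : SeqLT (itinerary f c₁ c₂ x) (itinerary f c₁ c₂ y)) : x < y :=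
  let ⟨_, hj⟩ := hxy
  h.lt_of_seqLTAt hx hy hj

end IsBimodal

/-! ### Reflection and folding -/

theorem Sym.conj_conj (X : Sym) : X.conj.conj = X := by cases X <;> rfl

/-- The unimodal symbol that corresponds to a bimodal symbol. -/
def Sym.fold : Sym → USym
  | .L => .r
  | .A => .c
  | .M => .l
  | .B => .c
  | .R => .r

theorem Sym.fold_conj (X : Sym) : X.conj.fold = X.fold := by cases X <;> rfl

theorem address_neg {c₁ c₂ : ℝ} (h : c₁ < c₂) (x : ℝ) :
    address (-c₂) (-c₁) (-x) = (address c₁ c₂ x).conj := by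
  simp only [address, neg_lt_neg_iff, neg_inj]
  split_ifs <;> first | rfl | (exfalso; grind)

theorem uaddress_eq_fold_address {c₁ c₂ x : ℝ} (hx : c₁ < x) :
    uaddress c₂ x = (address c₁ c₂ x).fold := by
  simp only [uaddress, address, hx.not_gt, hx.ne', if_false]
  split_ifs <;> rfl

/-- The map obtained from `f` by reflecting the line at `0`. -/
def reflect (f : ℝ → ℝ) (x : ℝ) : ℝ := -f (-x)

theorem reflect_neg (f : ℝ → ℝ) (x : ℝ) : reflect f (-x) = -f x := by rw [reflect, neg_neg]

theorem reflect_iterate_neg (f : ℝ → ℝ) (k : ℕ) (x : ℝ) :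
    (reflect f)^[k] (-x) = -f^[k] x :=
  (Function.Semiconj.iterate_right (f := Neg.neg) (fun x => (reflect_neg f x).symm) k x).symm

section Reflection

variable {f : ℝ → ℝ} {c₀ c₁ c₂ c₃ : ℝ}

theorem mapsTo_neg_Icc (a b : ℝ) : Set.MapsTo (fun x => -x) (Set.Icc (-b) (-a)) (Set.Icc a b) :=
  fun _ hx => ⟨le_neg_of_le_neg hx.2, neg_le_of_neg_le hx.1⟩

theorem IsBimodal.reflect (h : IsBimodal f c₀ c₁ c₂ c₃) :
    IsBimodal (reflect f) (-c₃) (-c₂) (-c₁) (-c₀) where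
  lt₀₁ := neg_lt_neg h.lt₂₃
  lt₁₂ := neg_lt_neg h.lt₁₂
  lt₂₃ := neg_lt_neg h.lt₀₁
  mapsTo _ hx := mapsTo_neg_Icc _ _ (by simpa only [neg_neg] using h.mapsTo (mapsTo_neg_Icc _ _ hx))
  continuousOn := (h.continuousOn.comp continuousOn_neg (mapsTo_neg_Icc _ _)).neg
  incr_left :=
    (h.incr_right.comp_strictAntiOn (strictMono_id.neg.strictAntiOn _) (mapsTo_neg_Icc _ _)).neg
  decr_middle :=
    (h.decr_middle.comp (strictMono_id.neg.strictAntiOn _) (mapsTo_neg_Icc _ _)).neg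
  incr_right :=
    (h.incr_left.comp_strictAntiOn (strictMono_id.neg.strictAntiOn _) (mapsTo_neg_Icc _ _)).neg

theorem Data.RealizedBy.reflect {S : Data} (h : S.RealizedBy f c₀ c₁ c₂ c₃) :
    S.RealizedBy (reflect f) (-c₃) (-c₂) (-c₁) (-c₀) := by
  refine ⟨h.1.reflect, fun j => ?_⟩
  rw [reflect_iterate_neg, reflect_iterate_neg, address_neg h.1.lt₁₂, address_neg h.1.lt₁₂,
    (h.2 j).1, (h.2 j).2, Sym.conj_conj]
  exact ⟨rfl, rfl⟩

end Reflection

/-! ### The two sides of the middle fixed point -/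

/-- A bimodal map whose fixed point `q` in the middle lap separates the first two iterates of
each turning point. The turning orbits of such a map alternate between the two sides of `q`. -/
structure IsInterchange (f : ℝ → ℝ) (c₀ c₁ c₂ c₃ q : ℝ) : Prop
    extends IsBimodal f c₀ c₁ c₂ c₃ where
  mem_Ioo : q ∈ Set.Ioo c₁ c₂
  apply_eq : f q = q
  lt_apply : q < f c₁
  apply_apply_lt : f (f c₁) < q
  apply_lt : f c₂ < q
  lt_apply_apply : q < f (f c₂)

section Existence

variable {S : Data} {f : ℝ → ℝ} {c₀ c₁ c₂ c₃ q : ℝ}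

theorem itinerary_eq_seqM (hq : q ∈ Set.Ioo c₁ c₂) (hfq : f q = q) :
    itinerary f c₁ c₂ q = seqM := by
  funext k
  rwa [itinerary, Function.iterate_fixed hfq, seqM, address_eq_M_iff]

theorem IsBimodal.mem_Icc (h : IsBimodal f c₀ c₁ c₂ c₃) {x : ℝ} (hx : x ∈ Set.Icc c₁ c₂) :
    x ∈ Set.Icc c₀ c₃ :=
  Set.Icc_subset_Icc h.lt₀₁.le h.lt₂₃.le hx

theorem IsBimodal.left_mem_Icc (h : IsBimodal f c₀ c₁ c₂ c₃) : c₁ ∈ Set.Icc c₀ c₃ :=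
  h.mem_Icc (Set.left_mem_Icc.2 h.lt₁₂.le)

theorem IsBimodal.right_mem_Icc (h : IsBimodal f c₀ c₁ c₂ c₃) : c₂ ∈ Set.Icc c₀ c₃ :=
  h.mem_Icc (Set.right_mem_Icc.2 h.lt₁₂.le)

namespace Data.RealizedBy

theorem seq_eq_itinerary (h : S.RealizedBy f c₀ c₁ c₂ c₃) :
    S.seq = itinerary f c₁ c₂ (f c₁) :=
  funext fun k => (h.2 k).1.symm

theorem left_lt_apply (h : S.RealizedBy f c₀ c₁ c₂ c₃) (hM : SeqLT seqM S.seq) : c₁ < f c₁ := by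
  rw [h.seq_eq_itinerary] at hM
  refine (monotone_val_address c₁ c₂).reflect_lt (lt_of_lt_of_le ?_ (val_zero_le_of_seqLT hM))
  simp [address, seqM, Sym.val]

theorem exists_fixedPoint (h : S.RealizedBy f c₀ c₁ c₂ c₃) (hM : SeqLT seqM S.seq) :
    ∃ q ∈ Set.Ioo c₁ c₂, f q = q := by
  have hright : f c₂ < c₂ := by
    simpa only [reflect_neg, neg_lt_neg_iff] using h.reflect.left_lt_apply hM
  have hcont : ContinuousOn (fun x => x - f x) (Set.Icc c₁ c₂) :=
    continuousOn_id.sub (h.1.continuousOn.mono fun _ => h.1.mem_Icc)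
  obtain ⟨q, hq, hzero⟩ := intermediate_value_Ioo h.1.lt₁₂.le hcont
    ⟨sub_neg.2 (h.left_lt_apply hM), sub_pos.2 hright⟩
  exact ⟨q, hq, (sub_eq_zero.1 hzero).symm⟩

theorem fixedPoint_lt_apply (h : S.RealizedBy f c₀ c₁ c₂ c₃) (hM : SeqLT seqM S.seq)
    (hq : q ∈ Set.Ioo c₁ c₂) (hfq : f q = q) : q < f c₁ := by
  rw [h.seq_eq_itinerary, ← itinerary_eq_seqM hq hfq] at hM
  exact h.1.lt_of_seqLT (h.1.mem_Icc (Set.Ioo_subset_Icc_self hq)) (h.1.mapsTo h.1.left_mem_Icc) hM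

theorem apply_apply_lt_fixedPoint (h : S.RealizedBy f c₀ c₁ c₂ c₃) (hM : SeqLT seqM S.seq)
    (hRM : SeqLT S.seq seqRM) (hq : q ∈ Set.Ioo c₁ c₂) (hfq : f q = q) : f (f c₁) < q := by
  have hlt := h.fixedPoint_lt_apply hM hq hfq
  have hq' := Set.Ioo_subset_Icc_self hq
  rcases le_or_gt (f c₁) c₂ with hle | hgt
  · exact (h.1.decr_middle hq' ⟨hq'.1.trans hlt.le, hle⟩ hlt).trans_eq hfq
  · have hR : itinerary f c₁ c₂ (f c₁) 0 = .R := (address_eq_R_iff h.1.lt₁₂).2 hgt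
    obtain ⟨_ | j, hj⟩ := h.seq_eq_itinerary ▸ hRM
    · rw [theta_zero, theta_zero, hR] at hj
      exact (lt_irrefl _ hj.2).elim
    · have htail := SeqLTAt.tail hj (by rw [hR]; rfl)
      exact h.1.lt_of_seqLT (h.1.mapsTo (h.1.mapsTo h.1.left_mem_Icc)) (h.1.mem_Icc hq')
        ⟨j, (itinerary_eq_seqM hq hfq).symm ▸ htail⟩

theorem exists_isInterchange (h : S.RealizedBy f c₀ c₁ c₂ c₃) (hM : SeqLT seqM S.seq)
    (hRM : SeqLT S.seq seqRM) : ∃ q, IsInterchange f c₀ c₁ c₂ c₃ q := by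
  obtain ⟨q, hq, hfq⟩ := h.exists_fixedPoint hM
  have hq' : -q ∈ Set.Ioo (-c₂) (-c₁) := ⟨neg_lt_neg hq.2, neg_lt_neg hq.1⟩
  have hfq' : SymBimodal.reflect f (-q) = -q := by rw [reflect_neg, hfq]
  have hlt := h.reflect.fixedPoint_lt_apply hM hq' hfq'
  have hlt' := h.reflect.apply_apply_lt_fixedPoint hM hRM hq' hfq'
  simp only [reflect_neg, neg_lt_neg_iff] at hlt hlt'
  exact ⟨q, h.1, hq, hfq, h.fixedPoint_lt_apply hM hq hfq,
    h.apply_apply_lt_fixedPoint hM hRM hq hfq, hlt, hlt'⟩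

end Data.RealizedBy

end Existence

/-- The points `f^k(c)` with `k` even and `f^k(c')` with `k` odd. -/
def altOrbit (f : ℝ → ℝ) (c c' : ℝ) (k : ℕ) : ℝ := f^[k] (if Even k then c else c')

section altOrbit

variable (f : ℝ → ℝ) (c c' : ℝ)

theorem altOrbit_zero : altOrbit f c c' 0 = c := by simp [altOrbit]

theorem altOrbit_succ (k : ℕ) : altOrbit f c c' (k + 1) = f (altOrbit f c' c k) := by
  rw [altOrbit, altOrbit, Function.iterate_succ_apply']
  by_cases hk : Even k <;> simp [hk, Nat.even_add_one]

theorem altOrbit_reflect : altOrbit (reflect f) (-c) (-c') = -altOrbit f c c' := by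
  ext k
  rw [Pi.neg_apply, altOrbit, altOrbit, ← reflect_iterate_neg, apply_ite Neg.neg]

theorem range_altOrbit : Set.range (altOrbit f c c') = evenOrbit f c ∪ oddOrbit f c' := by
  ext x
  constructor
  · rintro ⟨k, rfl⟩
    rcases Nat.even_or_odd' k with ⟨j, rfl | rfl⟩
    · exact Or.inl ⟨j, by simp [altOrbit]⟩
    · exact Or.inr ⟨j, by simp [altOrbit]⟩
  · rintro (⟨j, rfl⟩ | ⟨j, rfl⟩)
    · exact ⟨2 * j, by simp [altOrbit]⟩
    · exact ⟨2 * j + 1, by simp [altOrbit]⟩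

theorem orbit_eq_evenOrbit_union_oddOrbit : orbit f c = evenOrbit f c ∪ oddOrbit f c := by
  rw [← range_altOrbit, orbit]
  exact congrArg _ (funext fun k => by rw [altOrbit, ite_self])

theorem range_altOrbit_union_range_altOrbit :
    Set.range (altOrbit f c c') ∪ Set.range (altOrbit f c' c) = orbit f c ∪ orbit f c' := by
  rw [range_altOrbit, range_altOrbit, orbit_eq_evenOrbit_union_oddOrbit,
    orbit_eq_evenOrbit_union_oddOrbit, Set.union_comm (evenOrbit f c'), Set.union_union_union_comm,
    Set.union_comm (oddOrbit f c')]

end altOrbit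

namespace IsInterchange

variable {f : ℝ → ℝ} {c₀ c₁ c₂ c₃ q : ℝ}

theorem reflect (h : IsInterchange f c₀ c₁ c₂ c₃ q) :
    IsInterchange (reflect f) (-c₃) (-c₂) (-c₁) (-c₀) (-q) where
  toIsBimodal := h.toIsBimodal.reflect
  mem_Ioo := ⟨neg_lt_neg h.mem_Ioo.2, neg_lt_neg h.mem_Ioo.1⟩
  apply_eq := by rw [reflect_neg, h.apply_eq]
  lt_apply := by simpa only [reflect_neg, neg_lt_neg_iff] using h.apply_lt
  apply_apply_lt := by simpa only [reflect_neg, neg_lt_neg_iff] using h.lt_apply_apply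
  apply_lt := by simpa only [reflect_neg, neg_lt_neg_iff] using h.lt_apply
  lt_apply_apply := by simpa only [reflect_neg, neg_lt_neg_iff] using h.apply_apply_lt

theorem apply_left_le (h : IsInterchange f c₀ c₁ c₂ c₃ q) : f c₁ ≤ c₃ :=
  (h.mapsTo h.left_mem_Icc).2

theorem mapsTo_right (h : IsInterchange f c₀ c₁ c₂ c₃ q) :
    Set.MapsTo f (Set.Ioc q (f c₁)) (Set.Ico (f c₂) q) := by
  intro x hx
  rcases le_total x c₂ with hle | hge
  · have hmem : x ∈ Set.Icc c₁ c₂ := ⟨(h.mem_Ioo.1.trans hx.1).le, hle⟩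
    exact ⟨h.decr_middle.antitoneOn hmem (Set.right_mem_Icc.2 h.lt₁₂.le) hle,
      (h.decr_middle (Set.Ioo_subset_Icc_self h.mem_Ioo) hmem hx.1).trans_eq h.apply_eq⟩
  · have hmem : x ∈ Set.Icc c₂ c₃ := ⟨hge, hx.2.trans h.apply_left_le⟩
    exact ⟨h.incr_right.monotoneOn (Set.left_mem_Icc.2 h.lt₂₃.le) hmem hge,
      (h.incr_right.monotoneOn hmem ⟨hge.trans hx.2, h.apply_left_le⟩ hx.2).trans_lt
        h.apply_apply_lt⟩

theorem mapsTo_left (h : IsInterchange f c₀ c₁ c₂ c₃ q) :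
    Set.MapsTo f (Set.Ico (f c₂) q) (Set.Ioc q (f c₁)) := by
  intro x hx
  have hmem := h.reflect.mapsTo_right (x := -x)
    ⟨neg_lt_neg hx.2, by rw [reflect_neg]; exact neg_le_neg hx.1⟩
  simp only [reflect_neg] at hmem
  exact ⟨neg_lt_neg_iff.1 hmem.2, neg_le_neg_iff.1 hmem.1⟩

theorem altOrbit_succ_mem (h : IsInterchange f c₀ c₁ c₂ c₃ q) (k : ℕ) :
    altOrbit f c₂ c₁ (k + 1) ∈ Set.Ioc q (f c₁) ∧
      altOrbit f c₁ c₂ (k + 1) ∈ Set.Ico (f c₂) q := by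
  induction k with
  | zero =>
    rw [altOrbit_succ, altOrbit_succ, altOrbit_zero, altOrbit_zero]
    exact ⟨⟨h.lt_apply, le_rfl⟩, ⟨le_rfl, h.apply_lt⟩⟩
  | succ k ih =>
    rw [altOrbit_succ f c₂ c₁ (k + 1), altOrbit_succ f c₁ c₂ (k + 1)]
    exact ⟨h.mapsTo_left ih.2, h.mapsTo_right ih.1⟩

theorem lt_altOrbit (h : IsInterchange f c₀ c₁ c₂ c₃ q) (k : ℕ) : q < altOrbit f c₂ c₁ k := by
  rcases k with _ | k
  · exact h.mem_Ioo.2.trans_eq (altOrbit_zero _ _ _).symm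
  · exact (h.altOrbit_succ_mem k).1.1

theorem altOrbit_lt (h : IsInterchange f c₀ c₁ c₂ c₃ q) (k : ℕ) : altOrbit f c₁ c₂ k < q := by
  rcases k with _ | k
  · exact (altOrbit_zero _ _ _).trans_lt h.mem_Ioo.1
  · exact (h.altOrbit_succ_mem k).2.2

end IsInterchange

/-! ### The turning orbits of an interchange form a fold pair -/

theorem getD_append_self_mod {α : Type*} (l : List α) (hl : l ≠ []) (k : ℕ) (d : α) :
    (l ++ l).getD (k % (l ++ l).length) d = l.getD (k % l.length) d := by
  have hpos := List.length_pos_iff.2 hl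
  rw [List.length_append, ← Nat.mod_mod_of_dvd k (Dvd.intro_left 2 (two_mul l.length))]
  have hlt := Nat.mod_lt k (Nat.add_pos_left hpos l.length)
  set m := k % (l.length + l.length)
  rcases lt_or_ge m l.length with hm | hm
  · rw [Nat.mod_eq_of_lt hm, List.getD_append _ _ _ _ hm]
  · rw [Nat.mod_eq_sub_mod hm, Nat.mod_eq_of_lt (by omega), List.getD_append_right _ _ _ _ hm]

theorem Lap.fold_toSym (X : Lap) : X.toSym.fold = X.toULap.toUSym := by cases X <;> rfl

theorem Data.fold_seq (S : Data) (k : ℕ) : (S.seq k).fold = useq S.unimodal k := by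
  set l := S.unimodal.map ULap.toUSym ++ [USym.c] with hl
  have hlen : l.length = S.unimodal.length + 1 := by simp [l]
  have hmap (P : List Lap) (e : Lap → Sym) (he : ∀ X, (e X).fold = X.toULap.toUSym) :
      (P.map e).map Sym.fold = (P.map Lap.toULap).map ULap.toUSym := by
    simp only [List.map_map, List.map_inj_left, Function.comp_apply, he, implies_true]
  have hseq : (S.seq k).fold =
      (S.block.map Sym.fold).getD (k % (S.block.map Sym.fold).length) .c := by
    rw [List.length_map]
    exact (List.getD_map (l := S.block) .A Sym.fold).symm
  rw [hseq, useq, ← hl, ← hlen]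
  cases S with
  | pair P =>
    have hblock : (pair P).block.map Sym.fold = l := by
      rw [block, List.map_append, hmap P _ Lap.fold_toSym]
      rfl
    rw [hblock]
  | doubly P =>
    have hblock : (doubly P).block.map Sym.fold = l ++ l := by
      rw [block, List.append_assoc, List.map_append, List.map_append, List.map_append,
        hmap P _ Lap.fold_toSym, hmap P _ fun X => (Sym.fold_conj _).trans (Lap.fold_toSym X)]
      rfl
    rw [hblock, getD_append_self_mod l (by simp [hl])]

section FoldPair

variable {f : ℝ → ℝ} {c₀ c₁ c₂ c₃ q : ℝ}

theorem IsBimodal.altOrbit_mem (h : IsBimodal f c₀ c₁ c₂ c₃) (k : ℕ) :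
    altOrbit f c₂ c₁ k ∈ Set.Icc c₀ c₃ := by
  refine h.mapsTo.iterate k ?_
  split_ifs
  · exact h.right_mem_Icc
  · exact h.left_mem_Icc

theorem Data.RealizedBy.fold_address_altOrbit {S : Data} (h : S.RealizedBy f c₀ c₁ c₂ c₃) (k : ℕ) :
    (address c₁ c₂ (altOrbit f c₂ c₁ (k + 1))).fold = useq S.unimodal k := by
  rw [← S.fold_seq, altOrbit]
  split_ifs
  · rw [(h.2 k).2, Sym.fold_conj]
  · rw [(h.2 k).1]

theorem IsInterchange.isFold {S : Data} (hf : IsInterchange f c₀ c₁ c₂ c₃ q)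
    (h : S.RealizedBy f c₀ c₁ c₂ c₃) :
    IsFold S.unimodal (altOrbit f c₂ c₁) (-altOrbit f c₁ c₂) where
  uaddress_eq k := by
    rw [altOrbit_zero, uaddress_eq_fold_address (hf.mem_Ioo.1.trans (hf.lt_altOrbit _)),
      h.fold_address_altOrbit]
  cmp_left i j hi hj := by
    rw [altOrbit_zero] at hi hj
    rw [Pi.neg_apply, Pi.neg_apply, altOrbit_succ, altOrbit_succ]
    exact h.1.decr_middle.neg.cmp_map_eq ⟨(hf.mem_Ioo.1.trans (hf.lt_altOrbit i)).le, hi⟩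
      ⟨(hf.mem_Ioo.1.trans (hf.lt_altOrbit j)).le, hj⟩
  cmp_right i j hi hj := by
    rw [altOrbit_zero] at hi hj
    rw [Pi.neg_apply, Pi.neg_apply, altOrbit_succ, altOrbit_succ]
    exact h.1.incr_right.neg.cmp_map_eq ⟨hi, (h.1.altOrbit_mem i).2⟩ ⟨hj, (h.1.altOrbit_mem j).2⟩

theorem IsInterchange.isFoldPair {S : Data} (hf : IsInterchange f c₀ c₁ c₂ c₃ q)
    (h : S.RealizedBy f c₀ c₁ c₂ c₃) :
    IsFoldPair S.unimodal (altOrbit f c₂ c₁) (-altOrbit f c₁ c₂) := by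
  refine ⟨hf.isFold h, ?_⟩
  have hreflect := hf.reflect.isFold h.reflect
  rwa [altOrbit_reflect, altOrbit_reflect, neg_neg] at hreflect

end FoldPair

/-! ### The unimodal map obtained by folding -/

theorem nil_mem_setT : ([] : List ULap) ∈ setT := by
  refine ⟨fun x => -|x|, -1, 0, 1, ⟨by norm_num, by norm_num, fun x hx => ?_, by fun_prop,
    fun x hx y hy hxy => ?_, fun x hx y hy hxy => ?_⟩, fun j => ?_⟩
  · exact ⟨neg_le_neg (abs_le.2 hx), (neg_nonpos.2 (abs_nonneg x)).trans zero_le_one⟩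
  · simpa only [abs_of_nonpos hx.2, abs_of_nonpos hy.2, neg_neg] using hxy
  · simpa only [abs_of_nonneg hx.1, abs_of_nonneg hy.1, neg_lt_neg_iff] using hxy
  · have hfixed : (fun x : ℝ => -|x|)^[j + 1] 0 = 0 := Function.iterate_fixed (by simp) _
    rw [hfixed, uaddress_self, useq_eq_c_iff.2 (one_dvd _)]

namespace IsInterchange

variable {S : Data} {f H : ℝ → ℝ} {c₀ c₁ c₂ c₃ q : ℝ}

theorem right_lt_apply_left (hf : IsInterchange f c₀ c₁ c₂ c₃ q)
    (h : S.RealizedBy f c₀ c₁ c₂ c₃) (hS : S.unimodal ≠ []) : c₂ < f c₁ := by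
  have hle : c₂ ≤ f c₁ := by
    rw [← altOrbit_zero f c₂ c₁, ← (hf.isFoldPair h).periodic.eq]
    exact (hf.altOrbit_succ_mem _).1.2
  refine hle.lt_of_ne fun heq => hS ?_
  have hreturn : altOrbit f c₂ c₁ 1 = altOrbit f c₂ c₁ 0 := by
    rw [← zero_add 1, altOrbit_succ, altOrbit_zero, altOrbit_zero, heq]
  simpa using (hf.isFold h).eq_zero_iff.1 hreturn

theorem mapsTo_Icc (hf : IsInterchange f c₀ c₁ c₂ c₃ q) :
    Set.MapsTo f (Set.Icc q (f c₁)) (Set.Icc (f c₂) q) := by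
  intro x hx
  rcases hx.1.eq_or_lt with rfl | hlt
  · rw [hf.apply_eq]
    exact Set.right_mem_Icc.2 hf.apply_lt.le
  · exact Set.Ico_subset_Icc_self (hf.mapsTo_right ⟨hlt, hx.2⟩)

theorem isUnimodal_comp_neg (hf : IsInterchange f c₀ c₁ c₂ c₃ q) (hc : c₂ < f c₁)
    (hcont : Continuous H) (hmono : StrictMono H) (hq : H (-q) = q) (hmax : H (-f c₂) = f c₁) :
    IsUnimodal (fun x => H (-f x)) q c₂ (f c₁) where
  lt_left := hf.mem_Ioo.2
  lt_right := hc
  mapsTo x hx := by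
    have hfx := hf.mapsTo_Icc hx
    exact ⟨hq.symm.trans_le (hmono.monotone (neg_le_neg hfx.2)),
      (hmono.monotone (neg_le_neg hfx.1)).trans_eq hmax⟩
  continuousOn := hcont.comp_continuousOn (hf.continuousOn.mono
    (Set.Icc_subset_Icc (hf.lt₀₁.trans hf.mem_Ioo.1).le hf.apply_left_le)).neg
  incr_left := hmono.comp_strictMonoOn
    (hf.decr_middle.mono (Set.Icc_subset_Icc_left hf.mem_Ioo.1.le)).neg
  decr_right := hmono.comp_strictAntiOn
    (hf.incr_right.mono (Set.Icc_subset_Icc_right hf.apply_left_le)).neg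

-- A map `H` that carries the reflected left half of the turning orbits onto the right half turns
-- `f`, which interchanges the halves, into a self-map `H ∘ (-f)` of the right half.
theorem unimodal_mem_setT (hf : IsInterchange f c₀ c₁ c₂ c₃ q)
    (h : S.RealizedBy f c₀ c₁ c₂ c₃) : S.unimodal ∈ setT := by
  by_cases hS : S.unimodal = []
  · exact hS ▸ nil_mem_setT
  obtain ⟨π, hπ⟩ := exists_isPattern (P := S.unimodal) rfl
  have hpair := hf.isFoldPair h
  obtain ⟨H, hcont, hmono, hq, hH⟩ :=
    (hπ _ _ hpair.symm).exists_strictMono_map (hπ _ _ hpair)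
      (fun k => neg_lt_neg (hf.altOrbit_lt k)) hf.lt_altOrbit
  have hmax : H (-f c₂) = f c₁ := by
    simpa only [Pi.neg_apply, zero_add, altOrbit_succ, altOrbit_zero] using hH (0 + 1)
  have hiterate (k : ℕ) : (fun x => H (-f x))^[k] c₂ = altOrbit f c₂ c₁ k := by
    induction k with
    | zero => exact (altOrbit_zero _ _ _).symm
    | succ k ih =>
      rw [Function.iterate_succ_apply', ih, ← altOrbit_succ f c₁ c₂]
      exact hH (k + 1)
  refine ⟨_, q, c₂, f c₁,
    hf.isUnimodal_comp_neg (hf.right_lt_apply_left h hS) hcont hmono hq hmax, fun j => ?_⟩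
  rw [hiterate, ← (hf.isFold h).uaddress_eq, altOrbit_zero]

end IsInterchange

/-! ### Markov partitions -/

section Partition

variable {f : ℝ → ℝ} {m : ℕ} {z : Fin (m + 1) → ℝ} {σ : Fin (m + 1) → Fin (m + 1)}

theorem IsUnimodal.transitionMatrix_eq {b₀ c b₁ : ℝ} (h : IsUnimodal f b₀ c b₁)
    (hz : StrictMono z) (hmem : Set.range z ⊆ Set.Icc b₀ b₁) (hc : c ∈ Set.range z)
    (hσ : ∀ i, f (z i) = z (σ i)) : transitionMatrix f z = coverMatrix σ := by
  rw [Set.range_subset_iff] at hmem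
  refine transitionMatrix_eq_coverMatrix hz hσ
    (fun i => h.continuousOn.mono (Set.Icc_subset_Icc (hmem _).1 (hmem _).2)) fun i => ?_
  rcases le_castSucc_or_succ_le_of_mem_range hz.monotone hc i with hi | hi
  · exact .inr (h.decr_right.antitoneOn.mono (Set.Icc_subset_Icc hi (hmem _).2))
  · exact .inl (h.incr_left.monotoneOn.mono (Set.Icc_subset_Icc (hmem _).1 hi))

theorem IsBimodal.transitionMatrix_eq {c₀ c₁ c₂ c₃ : ℝ} (h : IsBimodal f c₀ c₁ c₂ c₃)
    (hz : StrictMono z) (hmem : Set.range z ⊆ Set.Icc c₀ c₃) (hc₁ : c₁ ∈ Set.range z)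
    (hc₂ : c₂ ∈ Set.range z) (hσ : ∀ i, f (z i) = z (σ i)) :
    transitionMatrix f z = coverMatrix σ := by
  rw [Set.range_subset_iff] at hmem
  refine transitionMatrix_eq_coverMatrix hz hσ
    (fun i => h.continuousOn.mono (Set.Icc_subset_Icc (hmem _).1 (hmem _).2)) fun i => ?_
  rcases le_castSucc_or_succ_le_of_mem_range hz.monotone hc₂ i with hi₂ | hi₂
  · exact .inl (h.incr_right.monotoneOn.mono (Set.Icc_subset_Icc hi₂ (hmem _).2))
  rcases le_castSucc_or_succ_le_of_mem_range hz.monotone hc₁ i with hi₁ | hi₁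
  · exact .inr (h.decr_middle.antitoneOn.mono (Set.Icc_subset_Icc hi₁ hi₂))
  · exact .inl (h.incr_left.monotoneOn.mono (Set.Icc_subset_Icc (hmem _).1 hi₁))

end Partition

section TurningOrbits

variable {n : ℕ} {π : Equiv.Perm (Fin (n + 1))}

theorem HasPattern.periodic_of_neg {α : Type*} [AddGroup α] [Preorder α] {x : ℕ → α}
    (h : HasPattern π (-x)) : Function.Periodic x (n + 1) :=
  fun k => neg_injective (h.periodic k)

theorem IsEnumeration.eq {m : ℕ} {z z' : Fin (m + 1) → ℝ} {X : Set ℝ} (h : IsEnumeration z X)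
    (h' : IsEnumeration z' X) : z = z' :=
  (h.1.range_inj h'.1).1 (h.2.trans h'.2.symm)

theorem orbit_subset {f : ℝ → ℝ} {x : ℝ} {s : Set ℝ} (hf : Set.MapsTo f s s) (hx : x ∈ s) :
    orbit f x ⊆ s :=
  Set.range_subset_iff.2 fun k => hf.iterate k hx

theorem HasPattern.isEnumeration_orbit {g : ℝ → ℝ} {c : ℝ} (h : HasPattern π fun k => g^[k] c) :
    IsEnumeration (fun i => g^[π i] c) (orbit g c) :=
  ⟨h.strictMono, range_comp_perm_of_periodic h.periodic π⟩

theorem URealizedBy.transitionMatrix_orbit {P : List ULap} {g : ℝ → ℝ} {b₀ c b₁ : ℝ}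
    (h : URealizedBy P g b₀ c b₁) (hπ : HasPattern π fun k => g^[k] c) :
    transitionMatrix g (fun i => g^[π i] c) = coverMatrix (nextIndex π) := by
  obtain ⟨hmono, hrange⟩ := hπ.isEnumeration_orbit
  refine h.1.transitionMatrix_eq hmono ?_ (hrange ▸ ⟨0, rfl⟩) fun i => ?_
  · exact hrange ▸ orbit_subset h.1.mapsTo ⟨h.1.lt_left.le, h.1.lt_right.le⟩
  · rw [← apply_succ_of_periodic hπ.periodic, Function.iterate_succ_apply']

/-- The points of the two turning orbits of a bimodal map, arranged as the alternating orbit of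
`c₁`, backwards, followed by the alternating orbit of `c₂`. This is the increasing order if `π` is
the pattern of either alternating orbit, counted outwards from the middle. -/
noncomputable def turningPoints (f : ℝ → ℝ) (c₁ c₂ : ℝ) (π : Equiv.Perm (Fin (n + 1))) :
    Fin (2 * n + 1 + 1) → ℝ :=
  mirrorJoin (fun i => altOrbit f c₁ c₂ (π i)) fun i => altOrbit f c₂ c₁ (π i)

variable {f : ℝ → ℝ} {c₀ c₁ c₂ c₃ q : ℝ}

theorem turningPoints_image_val_le (h : Function.Periodic (altOrbit f c₁ c₂) (n + 1)) :
    turningPoints f c₁ c₂ π '' {k | (k : ℕ) ≤ n} = evenOrbit f c₁ ∪ oddOrbit f c₂ := by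
  rw [turningPoints, mirrorJoin_image_val_le, range_comp_perm_of_periodic h, range_altOrbit]

theorem turningPoints_image_lt_val (h : Function.Periodic (altOrbit f c₂ c₁) (n + 1)) :
    turningPoints f c₁ c₂ π '' {k | n < (k : ℕ)} = oddOrbit f c₁ ∪ evenOrbit f c₂ := by
  rw [turningPoints, mirrorJoin_image_lt_val, range_comp_perm_of_periodic h, range_altOrbit,
    Set.union_comm]

theorem apply_turningPoints (h : Function.Periodic (altOrbit f c₁ c₂) (n + 1))
    (h' : Function.Periodic (altOrbit f c₂ c₁) (n + 1)) (k : Fin (2 * n + 1 + 1)) :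
    f (turningPoints f c₁ c₂ π k) = turningPoints f c₁ c₂ π (swapMap (nextIndex π) k) := by
  refine apply_mirrorJoin (fun i => ?_) (fun i => ?_) k
  · rw [← altOrbit_succ f c₂ c₁, apply_succ_of_periodic h']
  · rw [← altOrbit_succ f c₁ c₂, apply_succ_of_periodic h]

namespace IsInterchange

theorem isEnumeration_turningPoints (hf : IsInterchange f c₀ c₁ c₂ c₃ q)
    (h : HasPattern π (-altOrbit f c₁ c₂)) (h' : HasPattern π (altOrbit f c₂ c₁)) :
    IsEnumeration (turningPoints f c₁ c₂ π) (orbit f c₁ ∪ orbit f c₂) := by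
  constructor
  · exact strictMono_mirrorJoin (fun i j hij => neg_lt_neg_iff.1 (h.strictMono hij)) h'.strictMono
      fun i j => (hf.altOrbit_lt _).trans (hf.lt_altOrbit _)
  · rw [turningPoints, range_mirrorJoin, range_comp_perm_of_periodic h.periodic_of_neg,
      range_comp_perm_of_periodic h'.periodic, range_altOrbit_union_range_altOrbit]

theorem transitionMatrix_turningPoints (hf : IsInterchange f c₀ c₁ c₂ c₃ q)
    (h : HasPattern π (-altOrbit f c₁ c₂)) (h' : HasPattern π (altOrbit f c₂ c₁)) :
    transitionMatrix f (turningPoints f c₁ c₂ π) = coverMatrix (swapMap (nextIndex π)) := by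
  obtain ⟨hmono, hrange⟩ := hf.isEnumeration_turningPoints h h'
  refine hf.transitionMatrix_eq hmono ?_ (hrange ▸ .inl ⟨0, rfl⟩) (hrange ▸ .inr ⟨0, rfl⟩)
    (apply_turningPoints h.periodic_of_neg h'.periodic)
  exact hrange ▸ Set.union_subset (orbit_subset hf.mapsTo hf.left_mem_Icc)
    (orbit_subset hf.mapsTo hf.right_mem_Icc)

end IsInterchange

namespace Data

variable {S : Data}

theorem RealizedBy.exists_hasPattern (h : S.RealizedBy f c₀ c₁ c₂ c₃) (hM : SeqLT seqM S.seq)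
    (hRM : SeqLT S.seq seqRM) (hπ : IsPattern S.unimodal π) :
    ∃ q, IsInterchange f c₀ c₁ c₂ c₃ q ∧
      HasPattern π (-altOrbit f c₁ c₂) ∧ HasPattern π (altOrbit f c₂ c₁) := by
  obtain ⟨q, hf⟩ := h.exists_isInterchange hM hRM
  exact ⟨q, hf, hπ _ _ (hf.isFoldPair h).symm, hπ _ _ (hf.isFoldPair h)⟩

theorem unimodal_mem_setT (hS : S ∈ setD₁) : S.unimodal ∈ setT := by
  obtain ⟨⟨f, c₀, c₁, c₂, c₃, h⟩, hM, hRM⟩ := hS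
  obtain ⟨q, hf⟩ := h.exists_isInterchange hM hRM
  exact hf.unimodal_mem_setT h

theorem isMarkovMatrix_coverMatrix (hS : S ∈ setD₁) (hπ : IsPattern S.unimodal π) :
    S.IsMarkovMatrix (coverMatrix (swapMap (nextIndex π))) := by
  obtain ⟨hD, hM, hRM⟩ := hS
  refine ⟨hD, fun f c₀ c₁ c₂ c₃ h => ?_⟩
  obtain ⟨q, hf, hleft, hright⟩ := h.exists_hasPattern hM hRM hπ
  exact ⟨_, hf.isEnumeration_turningPoints hleft hright,
    (hf.transitionMatrix_turningPoints hleft hright).symm⟩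

theorem RealizedBy.image_enumeration (h : S.RealizedBy f c₀ c₁ c₂ c₃) (hM : SeqLT seqM S.seq)
    (hRM : SeqLT S.seq seqRM) (hπ : IsPattern S.unimodal π) {z : Fin (2 * n + 1 + 1) → ℝ}
    (hz : IsEnumeration z (orbit f c₁ ∪ orbit f c₂)) :
    z '' {k | (k : ℕ) ≤ n} = evenOrbit f c₁ ∪ oddOrbit f c₂ ∧
      z '' {k | n < (k : ℕ)} = oddOrbit f c₁ ∪ evenOrbit f c₂ := by
  obtain ⟨q, hf, hleft, hright⟩ := h.exists_hasPattern hM hRM hπ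
  rw [hz.eq (hf.isEnumeration_turningPoints hleft hright)]
  exact ⟨turningPoints_image_val_le hleft.periodic_of_neg,
    turningPoints_image_lt_val hright.periodic⟩

end Data

theorem uIsMarkovMatrix_coverMatrix {P : List ULap} (hP : P ∈ setT) (hπ : IsPattern P π) :
    UIsMarkovMatrix P (coverMatrix (nextIndex π)) := by
  refine ⟨hP, fun g b₀ c b₁ h => ?_⟩
  have hg := hπ _ _ h.isFoldPair
  exact ⟨_, hg.isEnumeration_orbit, (h.transitionMatrix_orbit hg).symm⟩

end TurningOrbits

end SymBimodal

theorem proposition1 (S : SymBimodal.Data) (hS : S ∈ SymBimodal.setD₁) (n : ℕ)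
    (hn : n = S.word.length) :
    S.unimodal ∈ SymBimodal.setT ∧
    (∃ (AS : Matrix (Fin (2 * n + 1)) (Fin (2 * n + 1)) ℤ) (AP : Matrix (Fin n) (Fin n) ℤ)
      (W₁ W₂ : Matrix Unit (Fin n) ℤ),
      S.IsMarkovMatrix AS ∧
      SymBimodal.UIsMarkovMatrix S.unimodal AP ∧
      AS.submatrix (SymBimodal.blockEquiv n) (SymBimodal.blockEquiv n) =
        Matrix.fromBlocks 1 (Matrix.fromCols W₁ W₂) 0 (Matrix.fromBlocks 0 AP AP 0) ∧
      (1 ≤ n → W₁ ≠ 0 ∧ W₂ ≠ 0)) ∧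
    (∀ (f : ℝ → ℝ) (c₀ c₁ c₂ c₃ : ℝ), S.RealizedBy f c₀ c₁ c₂ c₃ →
      ∀ z : Fin (2 * n + 1 + 1) → ℝ,
        SymBimodal.IsEnumeration z (SymBimodal.orbit f c₁ ∪ SymBimodal.orbit f c₂) →
        z '' {k | (k : ℕ) ≤ n} = SymBimodal.evenOrbit f c₁ ∪ SymBimodal.oddOrbit f c₂ ∧
        z '' {k | n < (k : ℕ)} = SymBimodal.oddOrbit f c₁ ∪ SymBimodal.evenOrbit f c₂) := by
  have hT := SymBimodal.Data.unimodal_mem_setT hS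
  have hlen : S.unimodal.length = n := by rw [SymBimodal.Data.unimodal, List.length_map, hn]
  obtain ⟨π, hπ⟩ := SymBimodal.exists_isPattern hlen
  have hrow (hn1 : 1 ≤ n) : SymBimodal.middleRow (SymBimodal.nextIndex π) ≠ 0 :=
    SymBimodal.middleRow_ne_zero hn1 (SymBimodal.nextIndex_zero_ne (Nat.one_le_iff_ne_zero.1 hn1) π)
  refine ⟨hT, ?_, fun f c₀ c₁ c₂ c₃ h z hz => h.image_enumeration hS.2.1 hS.2.2 hπ hz⟩
  exact ⟨_, _, _, _, SymBimodal.Data.isMarkovMatrix_coverMatrix hS hπ,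
    SymBimodal.uIsMarkovMatrix_coverMatrix hT hπ, SymBimodal.coverMatrix_swapMap _,
    fun hn1 => ⟨hrow hn1, hrow hn1⟩⟩
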